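/- Let $m,n\ge 0$ and let $\mathfrak g=\mathfrak{gl}(m|n)$ be the complex general linear Lie superalgebra, with Cartan subalgebra $\mathfrak h$ of diagonal matrices. Let $\delta_1,\dots,\delta_m,\epsilon_1,\dots,\epsilon_n$ be the basis of $\mathfrak h^*$ dual to the diagonal matrix units, so that the roots are the differences of two distinct elements of this basis. Let $\lambda=(\lambda_1\ge\lambda_2\ge\cdots)$ be an $(m|n)$-hook partition, i.e. $\lambda_{m+1}\le n$, with conjugate partition $\lambda'$. Put $$\lambda^\natural=\sum_{i=1}^m\lambda_i\delta_i+\sum_{j=1}^n\nu_j\epsilon_j,$$ where $\nu=(\lambda_{m+1},\lambda_{m+2},\dots)'$, and let $L(\lambda^\natural)$ be the simple $\mathfrak g$-module of highest weight $\lambda^\natural$ with respect to the standard (upper triangular) Borel subalgebra. Let $\mathfrak b\supseteq\mathfrak h$ be an arbitrary Borel subalgebra of $\mathfrak g$, i.e. $\mathfrak b=\mathfrak h\oplus\bigoplus_{\alpha\in\Phi^+}\mathfrak g_\alpha$ for a positive system $\Phi^+$. There is a unique ordering $\eta_1,\dots,\eta_{m+n}$ of $\delta_1,\dots,\delta_m,\epsilon_1,\dots,\epsilon_n$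 such that the simple roots of $\mathfrak b$ are $\eta_1-\eta_2,\dots,\eta_{m+n-1}-\eta_{m+n}$; dropping the indices gives the $\epsilon\delta$-sequence of $\mathfrak b$. Define $\lambda^{\mathfrak b}\in\mathfrak h^*$ by going through $\eta_1,\eta_2,\dots,\eta_{m+n}$ in this order, starting with the Young diagram of $\lambda$: if $\eta_k$ is a $\delta$, its coefficient is the length of the first row of the current diagram, and this row is removed; if $\eta_k$ is an $\epsilon$, its coefficient is the length of the first column of the current diagram, and this column is removed. **Theorem.** The $\mathfrak b$-highest weight of $L(\lambda^\natural)$ is $\lambda^{\mathfrak b}$: a weight $\mu\in\mathfrak h^*$ is the weight of a $\mathfrak b$-highest weight vector of $L(\lambda^\natural)$ if and only if $\mu=\lambda^{\mathfrak b}$. Suppose moreover that all simple roots of $\mathfrak b$ are odd, and for a partition $\mu$ let $p_i(\mu)=\max\{\mu_i-i+1,0\}$ and $q_i(\mu)=\max\{\mu'_i-i,0\}$, $i\ge1$, be its modified Frobenius coordinates. If the $\epsilon\delta$-sequence of $\mathfrak b$ starts with $\delta$, then in $\lambda^{\mathfrak b}$ the coefficient of the $i$-th $\delta$ of the ordering is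 $p_i(\lambda)$ and that of the $i$-th $\epsilon$ is $q_i(\lambda)$. If it starts with $\epsilon$, then the coefficient of the $i$-th $\epsilon$ is $p_i(\lambda')$ and that of the $i$-th $\delta$ is $q_i(\lambda')$. -/

import Mathlib

/-! ### The Lie superalgebra `gl(m|n)` -/

namespace GLSuper

/-- The index set `I(m|n)`: `Sum.inl i` is the barred index of `δ_i`, `Sum.inr j` the index of
`ε_j`. -/
abbrev Idx (m n : ℕ) : Type := Fin m ⊕ Fin n

/-- The underlying space of `gl(m|n)`: square matrices indexed by `I(m|n)`. -/
abbrev Gl (m n : ℕ) : Type := Matrix (Idx m n) (Idx m n) ℂ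

/-- Weights: the dual of the space of diagonal matrices, in the coordinates given by the basis
`δ_i, ε_j` dual to the diagonal matrix units. -/
abbrev Weight (m n : ℕ) : Type := Idx m n → ℂ

variable {m n : ℕ}

/-- The parity of a basis vector of `ℂ^{m|n}`. -/
def parity : Idx m n → ZMod 2
  | Sum.inl _ => 0
  | Sum.inr _ => 1

/-- The Koszul sign `(-1)^{s t}`. -/
def sign (s t : ZMod 2) : ℂ := (-1) ^ (s.val * t.val)

/-- The component of parity `s` of a matrix. -/
def part (s : ZMod 2) (x : Gl m n) : Gl m n :=
  Matrix.of fun i j => if parity i + parity j = s then x i j else 0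

/-- `x` is homogeneous of parity `s`. -/
def IsHomog (s : ZMod 2) (x : Gl m n) : Prop :=
  ∀ i j, parity i + parity j ≠ s → x i j = 0

/-- The bracket of `gl(m|n)`: the bilinear extension of `[x, y] = x y - (-1)^{|x||y|} y x` from
homogeneous matrices. -/
def superBracket (x y : Gl m n) : Gl m n :=
  ∑ s : ZMod 2, ∑ t : ZMod 2,
    (part s x * part t y - sign s t • (part t y * part s x))

/-- The matrix unit `E_{ij}`. -/
def E (i j : Idx m n) : Gl m n := Matrix.single i j 1

/-- The Cartan subalgebra of diagonal matrices. -/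
def cartan (m n : ℕ) : Submodule ℂ (Gl m n) where
  carrier := {x | ∀ i j, i ≠ j → x i j = 0}
  zero_mem' := fun _ _ _ => rfl
  add_mem' := fun {x y} hx hy i j h => by simp [hx i j h, hy i j h]
  smul_mem' := fun c x hx i j h => by simp [hx i j h]

/-- The weight `ε_i - ε_j` (with `ε_{\bar i} = δ_i`); for `i ≠ j` it is a root, whose root space
is spanned by `E i j`. -/
def root (i j : Idx m n) : Weight m n := Pi.single i 1 - Pi.single j 1

/-! ### Borel subalgebras -/

/-- A Borel subalgebra of `gl(m|n)` (containing the Cartan subalgebra of diagonal matrices): a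
subalgebra that contains the diagonal matrices and, of every pair of opposite root spaces, exactly
one. Equivalently, the sum of the Cartan subalgebra and of the root spaces of a positive system. -/
structure Borel (m n : ℕ) where
  carrier : Submodule ℂ (Gl m n)
  cartan_le : cartan m n ≤ carrier
  bracket_mem : ∀ x ∈ carrier, ∀ y ∈ carrier, superBracket x y ∈ carrier
  root_xor : ∀ i j, i ≠ j → Xor (E i j ∈ carrier) (E j i ∈ carrier)

lemma part_single (s : ZMod 2) (i j : Idx m n) :
    part s (E i j) = if parity i + parity j = s then E i j else 0 := by
  ext a b
  by_cases ha : i = a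
  · by_cases hb : j = b
    · subst ha hb
      by_cases h : parity i + parity j = s <;> simp [part, E, h]
    · by_cases h : parity i + parity j = s <;> simp [part, E, h, Matrix.single, hb]
  · by_cases h : parity i + parity j = s <;> simp [part, E, h, Matrix.single, ha]

lemma superBracket_E {i j k : Idx m n} (h : i ≠ k) :
    superBracket (E i j) (E j k) = E i k := by
  simp only [superBracket, part_single]
  rw [Finset.sum_eq_single (parity i + parity j), Finset.sum_eq_single (parity j + parity k)]
  · have h1 : E j k * E i j = (0 : Gl m n) := by
      simp [E, Matrix.single_mul_single_of_ne, h.symm]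
    have h2 : E i j * E j k = (E i k : Gl m n) := by simp [E]
    simp [h1, h2]
  · intro t _ ht
    simp [ht.symm]
  · simp
  · intro s _ hs
    simp [hs.symm]
  · simp

lemma part_blockTriangular {x : Gl m n} {s : ZMod 2}
    (hx : x.BlockTriangular (toLex : Idx m n → Fin m ⊕ₗ Fin n)) :
    (part s x).BlockTriangular (toLex : Idx m n → Fin m ⊕ₗ Fin n) := by
  intro i j hij
  simp [part, hx hij]

namespace Borel

/-- The standard Borel subalgebra: upper triangular matrices with respect to the order
`\bar 1 < ⋯ < \bar m < 1 < ⋯ < n`. -/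
def standard (m n : ℕ) : Borel m n where
  carrier :=
    { carrier := {x | x.BlockTriangular (toLex : Idx m n → Fin m ⊕ₗ Fin n)}
      zero_mem' := Matrix.blockTriangular_zero
      add_mem' := fun hx hy => hx.add hy
      smul_mem' := fun c x hx i j h => by simp [hx h] }
  cartan_le := fun x hx i j h => hx i j (by rintro rfl; exact lt_irrefl _ h)
  bracket_mem := fun x hx y hy => by
    refine Submodule.sum_mem _ fun s _ => Submodule.sum_mem _ fun t _ => Submodule.sub_mem _ ?_
      (Submodule.smul_mem _ _ ?_)
    · exact Matrix.BlockTriangular.mul (part_blockTriangular hx) (part_blockTriangular hy)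
    · exact Matrix.BlockTriangular.mul (part_blockTriangular hy) (part_blockTriangular hx)
  root_xor := fun i j hij => by
    have key : ∀ a b : Idx m n,
        (E a b).BlockTriangular (toLex : Idx m n → Fin m ⊕ₗ Fin n) ↔ toLex a ≤ toLex b := by
      intro a b
      constructor
      · intro h
        by_contra hlt
        have := h (not_le.mp hlt)
        simp [E] at this
      · intro h i j hlt
        have : ¬ (a = i ∧ b = j) := by
          rintro ⟨rfl, rfl⟩
          exact absurd hlt (not_lt.mpr h)
        simp only [E, Matrix.single, Matrix.of_apply, if_neg this]
    change Xor ((E i j).BlockTriangular _) ((E j i).BlockTriangular _)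
    rw [key, key]
    have hne : (toLex i : Fin m ⊕ₗ Fin n) ≠ toLex j := fun h => hij (toLex.injective h)
    rcases lt_or_gt_of_ne hne with h | h
    · exact Or.inl ⟨h.le, not_le.mpr h⟩
    · exact Or.inr ⟨h.le, not_le.mpr h⟩

variable (B : Borel m n)

/-- The nilradical `n⁺` of `b = h ⊕ n⁺`: the sum of the root spaces contained in `b`. -/
def nilradical : Submodule ℂ (Gl m n) :=
  Submodule.span ℂ {x | ∃ i j, i ≠ j ∧ E i j ∈ B.carrier ∧ x = E i j}

/-- The positive roots: the roots whose root space lies in `b`. -/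
def posRoots : Set (Weight m n) :=
  {α | ∃ i j, i ≠ j ∧ E i j ∈ B.carrier ∧ α = root i j}

/-- The simple roots: the positive roots that are not the sum of two positive roots. -/
def simpleRoots : Set (Weight m n) :=
  {α | α ∈ B.posRoots ∧ ¬ ∃ β ∈ B.posRoots, ∃ γ ∈ B.posRoots, α = β + γ}

/-- The order on `I(m|n)` defined by `b`: `i` precedes `j` if `i = j` or `ε_i - ε_j` is a positive
root. -/
def le (i j : Idx m n) : Prop := E i j ∈ B.carrier

lemma le_refl (i : Idx m n) : B.le i i := by
  refine B.cartan_le fun a b hab => ?_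
  have : ¬ (i = a ∧ i = b) := by
    rintro ⟨rfl, rfl⟩
    exact hab rfl
  simp only [E, Matrix.single, Matrix.of_apply, if_neg this]

instance : IsTrans (Idx m n) B.le where
  trans i j k hij hjk := by
    by_cases h : i = k
    · subst h
      exact B.le_refl i
    · have := B.bracket_mem _ hij _ hjk
      rwa [superBracket_E h] at this

instance : Std.Antisymm B.le where
  antisymm i j hij hji := by
    by_contra h
    rcases B.root_xor i j h with ⟨_, h'⟩ | ⟨_, h'⟩
    · exact h' hji
    · exact h' hij

instance : Std.Total B.le where
  total i j := by
    by_cases h : i = j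
    · subst h
      exact Or.inl (B.le_refl i)
    · rcases B.root_xor i j h with ⟨h', _⟩ | ⟨h', _⟩
      · exact Or.inl h'
      · exact Or.inr h'

open Classical in
/-- The list `i_1, …, i_{m+n}` of all indices for which the simple roots of `b` are
`ε_{i_1} - ε_{i_2}, …, ε_{i_{m+n-1}} - ε_{i_{m+n}}` (see `mem_simpleRoots_iff`). Its pattern of
`Sum.inl`s and `Sum.inr`s is the `εδ`-sequence of `b`. -/
noncomputable def indexSeq : List (Idx m n) := Finset.sort Finset.univ B.le

lemma mem_indexSeq (i : Idx m n) : i ∈ B.indexSeq := by simp [indexSeq]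

lemma nodup_indexSeq : B.indexSeq.Nodup := by
  classical exact Finset.sort_nodup _ _

lemma pairwise_indexSeq : B.indexSeq.Pairwise B.le := by
  classical exact Finset.pairwise_sort _ _

lemma le_getElem {a b : ℕ} (hab : a < b) (hb : b < B.indexSeq.length) :
    B.le B.indexSeq[a] B.indexSeq[b] :=
  List.pairwise_iff_getElem.mp B.pairwise_indexSeq a b (hab.trans hb) hb hab

lemma lt_of_le_getElem {a b : ℕ} (ha : a < B.indexSeq.length) (hb : b < B.indexSeq.length)
    (hne : B.indexSeq[a] ≠ B.indexSeq[b]) (h : B.le B.indexSeq[a] B.indexSeq[b]) : a < b := by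
  rcases lt_trichotomy a b with h' | h' | h'
  · exact h'
  · subst h'
    exact absurd rfl hne
  · exact absurd (Std.Antisymm.antisymm (r := B.le) _ _ h (B.le_getElem h' ha)) hne

/-- The simple roots of `b` are the differences of consecutive entries of `indexSeq`. -/
theorem mem_simpleRoots_iff (α : Weight m n) :
    α ∈ B.simpleRoots ↔ ∃ (k : ℕ) (h : k + 1 < B.indexSeq.length),
      α = root B.indexSeq[k] B.indexSeq[k + 1] := by
  have hinj : ∀ {a b : ℕ} (ha : a < B.indexSeq.length) (hb : b < B.indexSeq.length),
      a ≠ b → B.indexSeq[a] ≠ B.indexSeq[b] := fun ha hb hab h =>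
    hab ((B.nodup_indexSeq.getElem_inj_iff).mp h)
  constructor
  · rintro ⟨⟨i, j, hij, hle, rfl⟩, hno⟩
    obtain ⟨a, ha, rfl⟩ := List.getElem_of_mem (B.mem_indexSeq i)
    obtain ⟨b, hb, rfl⟩ := List.getElem_of_mem (B.mem_indexSeq j)
    have hab := B.lt_of_le_getElem ha hb hij hle
    by_cases hb' : b = a + 1
    · subst hb'
      exact ⟨a, hb, rfl⟩
    · have h1 : a + 1 < b := by omega
      have h2 : a + 1 < B.indexSeq.length := h1.trans hb
      refine absurd ⟨_, ⟨_, _, hinj ha h2 (by omega), B.le_getElem (by omega) h2, rfl⟩, _,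
        ⟨_, _, hinj h2 hb (by omega), B.le_getElem h1 hb, rfl⟩, ?_⟩ hno
      simp [root]
  · rintro ⟨k, hk, rfl⟩
    refine ⟨⟨_, _, hinj (by omega) hk (by omega), B.le_getElem (by omega) hk, rfl⟩, ?_⟩
    choose p hp hpe using fun i => List.getElem_of_mem (B.mem_indexSeq i)
    have hpk : ∀ (a : ℕ) (ha : a < B.indexSeq.length), p B.indexSeq[a] = a := fun a ha =>
      (B.nodup_indexSeq.getElem_inj_iff).mp (hpe B.indexSeq[a])
    let φ : Weight m n → ℂ := fun w => w ⬝ᵥ fun x => (p x : ℂ)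
    have hφ : ∀ i j, φ (root i j) = (p i : ℂ) - p j := by
      intro i j
      simp only [φ, root, sub_dotProduct, single_dotProduct, one_mul]
    have hlt : ∀ i j, i ≠ j → E i j ∈ B.carrier → p i < p j := by
      intro i j hij h
      apply B.lt_of_le_getElem (hp i) (hp j)
      · rwa [hpe, hpe]
      · rwa [hpe, hpe]
    rintro ⟨β, ⟨a, b, hab, hle, rfl⟩, γ, ⟨c, d, hcd, hle', rfl⟩, h⟩
    have h1 := hlt a b hab hle
    have h2 := hlt c d hcd hle'
    have h3 : φ (root B.indexSeq[k] B.indexSeq[k + 1]) = φ (root a b) + φ (root c d) := by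
      rw [h]
      exact add_dotProduct _ _ _
    rw [hφ, hφ, hφ, hpk, hpk] at h3
    have h4 : (k : ℤ) - (k + 1 : ℕ) = ((p a : ℤ) - p b) + ((p c : ℤ) - p d) := by
      exact_mod_cast h3
    omega

/-- The indices of the `δ`s, in the order in which they occur in the sequence of `b`. -/
noncomputable def deltaSeq : List (Fin m) := B.indexSeq.filterMap Sum.getLeft?

/-- The indices of the `ε`s, in the order in which they occur in the sequence of `b`. -/
noncomputable def epsSeq : List (Fin n) := B.indexSeq.filterMap Sum.getRight?

/-- All simple roots of `b` are odd. -/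
def AllOdd : Prop := ∀ i j, root i j ∈ B.simpleRoots → parity i ≠ parity j

end Borel

/-! ### Modules -/

/-- A module over the Lie superalgebra `gl(m|n)` on the complex vector space `L`: a
`ℤ/2`-grading of `L` and a parity preserving linear action compatible with the superbracket. -/
structure SuperModule (m n : ℕ) (L : Type*) [AddCommGroup L] [Module ℂ L] where
  grade : ZMod 2 → Submodule ℂ L
  isInternal : DirectSum.IsInternal grade
  act : Gl m n →ₗ[ℂ] Module.End ℂ L
  act_mem : ∀ s t x v, IsHomog s x → v ∈ grade t → act x v ∈ grade (s + t)
  act_bracket : ∀ s t x y, IsHomog s x → IsHomog t y →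
    act (superBracket x y) = act x * act y - sign s t • (act y * act x)

namespace SuperModule

variable {L : Type*} [AddCommGroup L] [Module ℂ L] (M : SuperModule m n L)

/-- A submodule: a graded subspace that is stable under the action. -/
def IsSubmodule (N : Submodule ℂ L) : Prop :=
  N ≤ ⨆ s, N ⊓ M.grade s ∧ ∀ x, ∀ v ∈ N, M.act x v ∈ N

/-- A simple module: nonzero and without proper nonzero submodules. -/
def IsSimple : Prop :=
  Nontrivial L ∧ ∀ N : Submodule ℂ L, M.IsSubmodule N → N = ⊥ ∨ N = ⊤

/-- `v` is a `b`-highest weight vector of weight `μ`. -/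
def IsHighestWeightVector (B : Borel m n) (μ : Weight m n) (v : L) : Prop :=
  v ≠ 0 ∧ (∀ x ∈ B.nilradical, M.act x v = 0) ∧
    ∀ h ∈ cartan m n, M.act h v = (∑ i, μ i * h i i) • v

/-- `μ` is a `b`-highest weight of the module, which is meant to be simple (so that it is
generated by any nonzero vector). -/
def HasHighestWeight (B : Borel m n) (μ : Weight m n) : Prop :=
  ∃ v, M.IsHighestWeightVector B μ v

end SuperModule

/-! ### Partitions and the weights read off from them -/

/-- `μ` with its first row removed. -/
noncomputable def removeRow (μ : YoungDiagram) : YoungDiagram where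
  cells := μ.cells.preimage (Prod.map (· + 1) id)
    ((add_left_injective 1).prodMap Function.injective_id).injOn
  isLowerSet := fun a b hba ha => by
    rw [Finset.coe_preimage] at ha ⊢
    exact μ.isLowerSet (Prod.mk_le_mk.mpr ⟨Nat.succ_le_succ hba.1, hba.2⟩) ha

/-- `μ` with its first column removed. -/
noncomputable def removeCol (μ : YoungDiagram) : YoungDiagram where
  cells := μ.cells.preimage (Prod.map id (· + 1))
    (Function.injective_id.prodMap (add_left_injective 1)).injOn
  isLowerSet := fun a b hba ha => by
    rw [Finset.coe_preimage] at ha ⊢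
    exact μ.isLowerSet (Prod.mk_le_mk.mpr ⟨hba.1, Nat.succ_le_succ hba.2⟩) ha

lemma mem_removeRow {μ : YoungDiagram} {i j : ℕ} : (i, j) ∈ removeRow μ ↔ (i + 1, j) ∈ μ := by
  rw [← YoungDiagram.mem_cells, ← YoungDiagram.mem_cells]
  simp [removeRow]

lemma mem_removeCol {μ : YoungDiagram} {i j : ℕ} : (i, j) ∈ removeCol μ ↔ (i, j + 1) ∈ μ := by
  rw [← YoungDiagram.mem_cells, ← YoungDiagram.mem_cells]
  simp [removeCol]

/-- `(m|n)`-hook partitions: `μ_{m+1} ≤ n`. (`rowLen i` is the length of row number `i + 1`.) -/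
def IsHook (m n : ℕ) (μ : YoungDiagram) : Prop := μ.rowLen m ≤ n

/-- The weight `μ^♮`: the first `m` row lengths of `μ` are the coefficients of the `δ`s, and the
column lengths of `μ` with the first `m` rows removed are those of the `ε`s. -/
noncomputable def natural (m n : ℕ) (μ : YoungDiagram) : Weight m n
  | Sum.inl i => μ.rowLen i
  | Sum.inr j => (removeRow^[m] μ).colLen j

/-- Read a weight off `μ` along a list of indices: for a `δ`, the length of the first row of the
current diagram, which is then removed; for an `ε`, the same with the first column. -/
noncomputable def readWeight : List (Idx m n) → YoungDiagram → Weight m n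
  | [], _ => 0
  | Sum.inl i :: l, μ =>
      Function.update (readWeight l (removeRow μ)) (Sum.inl i) (μ.rowLen 0 : ℂ)
  | Sum.inr j :: l, μ =>
      Function.update (readWeight l (removeCol μ)) (Sum.inr j) (μ.colLen 0 : ℂ)

/-- The weight `μ^b`. -/
noncomputable def borelWeight (B : Borel m n) (μ : YoungDiagram) : Weight m n :=
  readWeight B.indexSeq μ

/-- The modified Frobenius coordinate `p_i = max (μ_i - i + 1, 0)`, for `i = k + 1`. -/
def frobP (μ : YoungDiagram) (k : ℕ) : ℤ := max ((μ.rowLen k : ℤ) - (k + 1) + 1) 0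

/-- The modified Frobenius coordinate `q_i = max (μ'_i - i, 0)`, for `i = k + 1`. -/
def frobQ (μ : YoungDiagram) (k : ℕ) : ℤ := max ((μ.colLen k : ℤ) - (k + 1)) 0

end GLSuper

/-!
A positive system is an ordering of the indices, and any two orderings are linked by interchanges
of adjacent indices `a, b`, that is, by reflections in the simple root `root a b`. Under such a
reflection a highest weight vector `v` of a simple module is replaced by the last nonzero vector
among the powers of `E b a` applied to `v`. Its weight is determined by `sl₂`-theory if the root is
even, and by whether `v` is killed by `E a b * E b a`, i.e. whether the weight is orthogonal to the
root, if the root is odd. Reading a Young diagram in the two orderings changes the weight in the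
same way: if exactly one of `a, b` is a `δ`, then both readings agree unless the corner cell of the
current diagram exists, in which case they differ by the one cell that is counted by whichever
index comes first.

The highest weight is unique since all weights of the module lie in `μ` minus the positive cone,
which contains no line. If all simple roots are odd, then `δ`s and `ε`s alternate, so the numbers of
rows and columns removed before a given index are known, and the coefficients are the Frobenius
coordinates.
-/

namespace GLSuper

variable {m n : ℕ}

/-- How the highest weight of a simple module changes when the Borel subalgebra is reflected in
the simple root `root a b`: an even reflection interchanges two coefficients, an odd one subtracts
the root unless the weight is orthogonal to it, where `(μ, δ_i - ε_j) = μ (inl i) + μ (inr j)`. -/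
noncomputable def reflect (a b : Idx m n) (μ : Weight m n) : Weight m n :=
  open Classical in
  if parity a = parity b then μ ∘ Equiv.swap a b else if μ a + μ b = 0 then μ else μ - root a b

lemma reflect_of_parity_eq {a b : Idx m n} (hpar : parity a = parity b) (μ : Weight m n) :
    reflect a b μ = μ ∘ Equiv.swap a b := if_pos hpar

lemma reflect_of_add_eq_zero {a b : Idx m n} (hpar : parity a ≠ parity b) {μ : Weight m n}
    (h : μ a + μ b = 0) : reflect a b μ = μ := by rw [reflect, if_neg hpar, if_pos h]

lemma reflect_of_add_ne_zero {a b : Idx m n} (hpar : parity a ≠ parity b) {μ : Weight m n}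
    (h : μ a + μ b ≠ 0) : reflect a b μ = μ - root a b := by
  rw [reflect, if_neg hpar, if_neg h]

lemma reflect_eq_add_smul_root {a b : Idx m n} (hpar : parity a = parity b) {μ : Weight m n}
    {c : ℂ} (hc : μ a = μ b + c) : reflect a b μ = μ + c • root b a := by
  rw [reflect_of_parity_eq hpar]
  funext x
  rcases eq_or_ne a b with rfl | hab
  · simp [root]
  rcases eq_or_ne x a with rfl | hxa
  · simp [root, hab, hc]
  rcases eq_or_ne x b with rfl | hxb
  · simp [root, hxa, hc]
  simp [root, hxa, hxb, Equiv.swap_apply_of_ne_of_ne]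

lemma reflect_apply_of_ne {a b x : Idx m n} (ha : x ≠ a) (hb : x ≠ b) (μ : Weight m n) :
    reflect a b μ x = μ x := by
  rw [reflect]
  split_ifs <;> simp [root, Equiv.swap_apply_of_ne_of_ne, ha, hb]

/-! ### Weights read off a Young diagram -/

lemma rowLen_removeRow (μ : YoungDiagram) (i : ℕ) : (removeRow μ).rowLen i = μ.rowLen (i + 1) :=
  eq_of_forall_lt_iff fun k => by
    rw [← YoungDiagram.mem_iff_lt_rowLen, ← YoungDiagram.mem_iff_lt_rowLen, mem_removeRow]

lemma colLen_removeCol (μ : YoungDiagram) (j : ℕ) : (removeCol μ).colLen j = μ.colLen (j + 1) :=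
  eq_of_forall_lt_iff fun k => by
    rw [← YoungDiagram.mem_iff_lt_colLen, ← YoungDiagram.mem_iff_lt_colLen, mem_removeCol]

lemma colLen_removeRow (μ : YoungDiagram) (j : ℕ) : (removeRow μ).colLen j = μ.colLen j - 1 :=
  eq_of_forall_lt_iff fun k => by
    rw [← YoungDiagram.mem_iff_lt_colLen, mem_removeRow, YoungDiagram.mem_iff_lt_colLen]
    omega

lemma rowLen_removeCol (μ : YoungDiagram) (i : ℕ) : (removeCol μ).rowLen i = μ.rowLen i - 1 :=
  eq_of_forall_lt_iff fun k => by
    rw [← YoungDiagram.mem_iff_lt_rowLen, mem_removeCol, YoungDiagram.mem_iff_lt_rowLen]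
    omega

lemma removeRow_removeCol (μ : YoungDiagram) :
    removeRow (removeCol μ) = removeCol (removeRow μ) := by
  ext ⟨i, j⟩
  simp only [YoungDiagram.mem_cells, mem_removeRow, mem_removeCol]

lemma colLen_iterate_removeRow (k : ℕ) (μ : YoungDiagram) (j : ℕ) :
    (removeRow^[k] μ).colLen j = μ.colLen j - k := by
  induction k generalizing μ with
  | zero => rfl
  | succ k ih => rw [Function.iterate_succ_apply, ih, colLen_removeRow, Nat.sub_sub, add_comm]

/-- The number of `δ`s in a list of indices. -/
def deltaCount (l : List (Idx m n)) : ℕ := (l.filterMap Sum.getLeft?).length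

/-- The number of `ε`s in a list of indices. -/
def epsCount (l : List (Idx m n)) : ℕ := (l.filterMap Sum.getRight?).length

@[simp] lemma deltaCount_cons_inl (i : Fin m) (l : List (Idx m n)) :
    deltaCount (Sum.inl i :: l) = deltaCount l + 1 := rfl

@[simp] lemma deltaCount_cons_inr (j : Fin n) (l : List (Idx m n)) :
    deltaCount (Sum.inr j :: l) = deltaCount l := rfl

@[simp] lemma epsCount_cons_inl (i : Fin m) (l : List (Idx m n)) :
    epsCount (Sum.inl i :: l) = epsCount l := rfl

@[simp] lemma epsCount_cons_inr (j : Fin n) (l : List (Idx m n)) :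
    epsCount (Sum.inr j :: l) = epsCount l + 1 := rfl

@[simp] lemma deltaCount_nil : deltaCount ([] : List (Idx m n)) = 0 := rfl

@[simp] lemma epsCount_nil : epsCount ([] : List (Idx m n)) = 0 := rfl

@[simp] lemma deltaCount_append (l l' : List (Idx m n)) :
    deltaCount (l ++ l') = deltaCount l + deltaCount l' := by
  rw [deltaCount, List.filterMap_append, List.length_append, deltaCount, deltaCount]

@[simp] lemma epsCount_append (l l' : List (Idx m n)) :
    epsCount (l ++ l') = epsCount l + epsCount l' := by
  rw [epsCount, List.filterMap_append, List.length_append, epsCount, epsCount]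

/-- The coefficient read off `μ` for the index `x` after the indices in `pre`: if `pre` contains
`r` `δ`s and `c` `ε`s, then reading `pre` removes the first `r` rows and `c` columns. The truncated
subtraction accounts for the rows and columns that have become empty. -/
def readCoeff (μ : YoungDiagram) (pre : List (Idx m n)) : Idx m n → ℕ
  | Sum.inl _ => μ.rowLen (deltaCount pre) - epsCount pre
  | Sum.inr _ => μ.colLen (epsCount pre) - deltaCount pre

lemma readCoeff_cons_inl (μ : YoungDiagram) (i : Fin m) (pre : List (Idx m n)) (x : Idx m n) :
    readCoeff μ (Sum.inl i :: pre) x = readCoeff (removeRow μ) pre x := by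
  cases x <;> simp [readCoeff, rowLen_removeRow, colLen_removeRow, Nat.sub_sub, add_comm]

lemma readCoeff_cons_inr (μ : YoungDiagram) (j : Fin n) (pre : List (Idx m n)) (x : Idx m n) :
    readCoeff μ (Sum.inr j :: pre) x = readCoeff (removeCol μ) pre x := by
  cases x <;> simp [readCoeff, rowLen_removeCol, colLen_removeCol, Nat.sub_sub, add_comm]

lemma readWeight_append_cons_self {pre : List (Idx m n)} {x : Idx m n} (hx : x ∉ pre)
    (suf : List (Idx m n)) (μ : YoungDiagram) :
    readWeight (pre ++ x :: suf) μ x = readCoeff μ pre x := by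
  induction pre generalizing μ with
  | nil => cases x <;> simp [readWeight, readCoeff]
  | cons y pre ih =>
    rw [List.mem_cons, not_or] at hx
    cases y
    · rw [List.cons_append, readWeight, Function.update_of_ne hx.1, ih hx.2, readCoeff_cons_inl]
    · rw [List.cons_append, readWeight, Function.update_of_ne hx.1, ih hx.2, readCoeff_cons_inr]

lemma notMem_of_nodup_append_cons {α : Type*} {pre suf : List α} {x : α}
    (h : (pre ++ x :: suf).Nodup) : x ∉ pre := fun hx =>
  List.disjoint_of_nodup_append h hx List.mem_cons_self

lemma readWeight_append_cons_cons_self {pre : List (Idx m n)} {a b : Idx m n} (hab : a ≠ b)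
    (hb : b ∉ pre) (suf : List (Idx m n)) (μ : YoungDiagram) :
    readWeight (pre ++ a :: b :: suf) μ b = readCoeff μ (pre ++ [a]) b := by
  rw [List.append_cons]
  exact readWeight_append_cons_self (by simp [hb, hab.symm]) suf μ

lemma readWeight_swap_apply_of_ne {a b x : Idx m n} (ha : x ≠ a) (hb : x ≠ b)
    (pre suf : List (Idx m n)) (μ : YoungDiagram) :
    readWeight (pre ++ b :: a :: suf) μ x = readWeight (pre ++ a :: b :: suf) μ x := by
  induction pre generalizing μ with
  | nil => cases a <;> cases b <;> simp [readWeight, ha, hb, removeRow_removeCol]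
  | cons y pre ih => cases y <;> simp only [List.cons_append, readWeight, Function.update_apply, ih]

lemma readCoeff_append_singleton_of_parity_eq {a b : Idx m n} (hpar : parity a = parity b)
    (pre : List (Idx m n)) (μ : YoungDiagram) :
    readCoeff μ (pre ++ [b]) a = readCoeff μ (pre ++ [a]) b := by
  rcases a with a | a <;> rcases b with b | b <;>
    simp [parity, readCoeff] at hpar ⊢

lemma readCoeff_eq_of_parity_eq {a b : Idx m n} (hpar : parity a = parity b)
    (pre : List (Idx m n)) (μ : YoungDiagram) : readCoeff μ pre a = readCoeff μ pre b := by
  rcases a with a | a <;> rcases b with b | b <;> simp [parity, readCoeff] at hpar ⊢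

lemma readCoeff_append_singleton_le {a b : Idx m n} (hpar : parity a = parity b)
    (pre : List (Idx m n)) (μ : YoungDiagram) :
    readCoeff μ (pre ++ [a]) b ≤ readCoeff μ pre a := by
  rcases a with a | a <;> rcases b with b | b <;> simp [parity] at hpar
  · have := μ.rowLen_anti _ _ (Nat.le_add_right (deltaCount pre) 1)
    simpa [readCoeff] using by omega
  · have := μ.colLen_anti _ _ (Nat.le_add_right (epsCount pre) 1)
    simpa [readCoeff] using by omega

/- The two cases are whether the cell in row `deltaCount pre` and column `epsCount pre`, the corner
of the diagram that remains after reading `pre`, belongs to `μ`. -/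
lemma readCoeff_append_singleton_of_parity_ne {a b : Idx m n} (hpar : parity a ≠ parity b)
    (pre : List (Idx m n)) (μ : YoungDiagram) :
    (readCoeff μ pre a = 0 ∧ readCoeff μ (pre ++ [a]) b = 0 ∧
      readCoeff μ pre b = 0 ∧ readCoeff μ (pre ++ [b]) a = 0) ∨
    (readCoeff μ pre a = readCoeff μ (pre ++ [b]) a + 1 ∧
      readCoeff μ pre b = readCoeff μ (pre ++ [a]) b + 1) := by
  have hcorner : epsCount pre < μ.rowLen (deltaCount pre) ↔
      deltaCount pre < μ.colLen (epsCount pre) := by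
    rw [← YoungDiagram.mem_iff_lt_rowLen, ← YoungDiagram.mem_iff_lt_colLen]
  rcases a with a | a <;> rcases b with b | b <;>
    simp [parity, readCoeff] at hpar hcorner ⊢ <;> omega

theorem readWeight_swap {a b : Idx m n} (hab : a ≠ b) {pre : List (Idx m n)} (ha : a ∉ pre)
    (hb : b ∉ pre) (suf : List (Idx m n)) (μ : YoungDiagram) :
    readWeight (pre ++ b :: a :: suf) μ = reflect a b (readWeight (pre ++ a :: b :: suf) μ) := by
  have hwa := readWeight_append_cons_self ha (b :: suf) μ
  have hwb := readWeight_append_cons_cons_self hab hb suf μ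
  suffices
      (readCoeff μ (pre ++ [b]) a : ℂ) = reflect a b (readWeight (pre ++ a :: b :: suf) μ) a ∧
      (readCoeff μ pre b : ℂ) = reflect a b (readWeight (pre ++ a :: b :: suf) μ) b by
    funext x
    rcases eq_or_ne x a with rfl | hxa
    · rw [readWeight_append_cons_cons_self hab.symm ha, this.1]
    rcases eq_or_ne x b with rfl | hxb
    · rw [readWeight_append_cons_self hb, this.2]
    rw [readWeight_swap_apply_of_ne hxa hxb, reflect_apply_of_ne hxa hxb]
  by_cases hpar : parity a = parity b
  · rw [reflect_of_parity_eq hpar]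
    exact ⟨by simp [hwb, readCoeff_append_singleton_of_parity_eq hpar],
      by simp [hwa, readCoeff_eq_of_parity_eq hpar]⟩
  rcases readCoeff_append_singleton_of_parity_ne hpar pre μ with ⟨h₁, h₂, h₃, h₄⟩ | ⟨h₁, h₂⟩
  · have horth : readWeight (pre ++ a :: b :: suf) μ a +
        readWeight (pre ++ a :: b :: suf) μ b = 0 := by simp [hwa, hwb, h₁, h₂]
    simp [reflect_of_add_eq_zero hpar horth, hwa, hwb, h₁, h₂, h₃, h₄]
  · have horth : readWeight (pre ++ a :: b :: suf) μ a +
        readWeight (pre ++ a :: b :: suf) μ b ≠ 0 := by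
      rw [hwa, hwb, h₁]
      norm_cast
      omega
    simp [reflect_of_add_ne_zero hpar horth, hwa, hwb, h₁, h₂, root, hab, hab.symm]

lemma exists_readWeight_eq_add {a b : Idx m n} (hab : a ≠ b) (hpar : parity a = parity b)
    {pre : List (Idx m n)} (ha : a ∉ pre) (hb : b ∉ pre) (suf : List (Idx m n))
    (μ : YoungDiagram) :
    ∃ k : ℕ, readWeight (pre ++ a :: b :: suf) μ a =
      readWeight (pre ++ a :: b :: suf) μ b + k := by
  obtain ⟨k, hk⟩ := Nat.exists_eq_add_of_le (readCoeff_append_singleton_le hpar pre μ)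
  refine ⟨k, ?_⟩
  rw [readWeight_append_cons_self ha, readWeight_append_cons_cons_self hab hb, hk, Nat.cast_add]

/-! ### Modified Frobenius coordinates -/

lemma frobP_eq (μ : YoungDiagram) (k : ℕ) : frobP μ k = (μ.rowLen k - k : ℕ) := by
  rw [frobP]
  omega

lemma frobQ_eq (μ : YoungDiagram) (k : ℕ) : frobQ μ k = (μ.colLen k - (k + 1) : ℕ) := by
  rw [frobQ]
  omega

lemma exists_eq_append_of_getElem?_filterMap {α β : Type*} {f : α → Option β} {l : List α} {k : ℕ}
    {b : β} (h : (l.filterMap f)[k]? = some b) :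
    ∃ pre x suf, l = pre ++ x :: suf ∧ f x = some b ∧ (pre.filterMap f).length = k := by
  induction l generalizing k with
  | nil => simp at h
  | cons y l ih =>
    cases hy : f y with
    | none =>
      rw [List.filterMap_cons_none hy] at h
      obtain ⟨pre, x, suf, rfl, hx, rfl⟩ := ih h
      exact ⟨y :: pre, x, suf, rfl, hx, by rw [List.filterMap_cons_none hy]⟩
    | some c =>
      rw [List.filterMap_cons_some hy] at h
      cases k with
      | zero => exact ⟨[], y, l, rfl, by simpa [hy] using h, rfl⟩
      | succ k =>
        obtain ⟨pre, x, suf, rfl, hx, rfl⟩ := ih (by simpa using h)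
        exact ⟨y :: pre, x, suf, rfl, hx, by rw [List.filterMap_cons_some hy, List.length_cons]⟩

lemma deltaCount_add_parity {y x : Idx m n} {pre suf : List (Idx m n)}
    (hchain : (pre ++ x :: suf).IsChain (parity · ≠ parity ·))
    (hhead : (pre ++ x :: suf).head? = some y) :
    deltaCount pre + (parity y).val = epsCount pre + (parity x).val := by
  induction pre generalizing y with
  | nil =>
    obtain rfl : x = y := by simpa using hhead
    rfl
  | cons z pre ih =>
    obtain rfl : z = y := by simpa using hhead
    rw [List.cons_append, List.isChain_cons] at hchain
    obtain ⟨y', hy'⟩ : ∃ y', (pre ++ x :: suf).head? = some y' := by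
      cases pre <;> exact ⟨_, rfl⟩
    have hne := hchain.1 y' hy'
    have ih := ih hchain.2 hy'
    rcases z with z | z <;> rcases y' with y' | y' <;> simp [parity, ZMod.val_one] at hne ih ⊢ <;>
      omega

lemma readWeight_inl_of_isChain {l : List (Idx m n)} (hnodup : l.Nodup)
    (hchain : l.IsChain (parity · ≠ parity ·)) {y : Idx m n} (hhead : l.head? = some y)
    {k : ℕ} {i : Fin m} (hi : (l.filterMap Sum.getLeft?)[k]? = some i) (μ : YoungDiagram) :
    readWeight l μ (Sum.inl i) = (μ.rowLen k - (k + (parity y).val) : ℕ) := by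
  obtain ⟨pre, x, suf, rfl, hx, rfl⟩ := exists_eq_append_of_getElem?_filterMap hi
  obtain rfl := Sum.getLeft?_eq_some_iff.mp hx
  have hcount := deltaCount_add_parity hchain hhead
  rw [readWeight_append_cons_self (notMem_of_nodup_append_cons hnodup),
    readCoeff, ← deltaCount, hcount]
  rfl

lemma readWeight_inr_of_isChain {l : List (Idx m n)} (hnodup : l.Nodup)
    (hchain : l.IsChain (parity · ≠ parity ·)) {y : Idx m n} (hhead : l.head? = some y)
    {k : ℕ} {j : Fin n} (hj : (l.filterMap Sum.getRight?)[k]? = some j) (μ : YoungDiagram) :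
    readWeight l μ (Sum.inr j) = (μ.colLen k - (k + 1 - (parity y).val) : ℕ) := by
  obtain ⟨pre, x, suf, rfl, hx, rfl⟩ := exists_eq_append_of_getElem?_filterMap hj
  obtain rfl := Sum.getRight?_eq_some_iff.mp hx
  have hcount : deltaCount pre + (parity y).val = epsCount pre + 1 :=
    deltaCount_add_parity hchain hhead
  rw [readWeight_append_cons_self (notMem_of_nodup_append_cons hnodup),
    readCoeff, ← epsCount, ← hcount, Nat.add_sub_cancel]

namespace Borel

variable {B : Borel m n}

lemma AllOdd.isChain (h : B.AllOdd) : B.indexSeq.IsChain (parity · ≠ parity ·) :=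
  List.isChain_iff_getElem.mpr fun k hk =>
    h _ _ ((B.mem_simpleRoots_iff _).mpr ⟨k, hk, rfl⟩)

theorem AllOdd.borelWeight_inl (h : B.AllOdd) {y : Idx m n} (hy : B.indexSeq.head? = some y)
    {k : ℕ} {i : Fin m} (hi : B.deltaSeq[k]? = some i) (μ : YoungDiagram) :
    borelWeight B μ (Sum.inl i) = (μ.rowLen k - (k + (parity y).val) : ℕ) :=
  readWeight_inl_of_isChain B.nodup_indexSeq h.isChain hy hi μ

theorem AllOdd.borelWeight_inr (h : B.AllOdd) {y : Idx m n} (hy : B.indexSeq.head? = some y)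
    {k : ℕ} {j : Fin n} (hj : B.epsSeq[k]? = some j) (μ : YoungDiagram) :
    borelWeight B μ (Sum.inr j) = (μ.colLen k - (k + 1 - (parity y).val) : ℕ) :=
  readWeight_inr_of_isChain B.nodup_indexSeq h.isChain hy hj μ

end Borel

/-! ### The standard Borel subalgebra -/

/-- The indices in the standard order `δ_1, …, δ_m, ε_1, …, ε_n`. -/
def standardSeq (m n : ℕ) : List (Idx m n) :=
  (List.finRange m).map Sum.inl ++ (List.finRange n).map Sum.inr

lemma mem_standardSeq (x : Idx m n) : x ∈ standardSeq m n := by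
  cases x <;> simp [standardSeq]

lemma nodup_standardSeq : (standardSeq m n).Nodup := by
  simp [standardSeq, List.nodup_append, List.nodup_map_iff Sum.inl_injective,
    List.nodup_map_iff Sum.inr_injective, List.nodup_finRange]

lemma deltaCount_map_inl (l : List (Fin m)) :
    deltaCount (l.map Sum.inl : List (Idx m n)) = l.length := by
  induction l with
  | nil => rfl
  | cons i l ih => rw [List.map_cons, deltaCount_cons_inl, ih, List.length_cons]

lemma epsCount_map_inl (l : List (Fin m)) : epsCount (l.map Sum.inl : List (Idx m n)) = 0 := by
  induction l with
  | nil => rfl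
  | cons i l ih => rw [List.map_cons, epsCount_cons_inl, ih]

lemma deltaCount_map_inr (l : List (Fin n)) : deltaCount (l.map Sum.inr : List (Idx m n)) = 0 := by
  induction l with
  | nil => rfl
  | cons i l ih => rw [List.map_cons, deltaCount_cons_inr, ih]

lemma epsCount_map_inr (l : List (Fin n)) :
    epsCount (l.map Sum.inr : List (Idx m n)) = l.length := by
  induction l with
  | nil => rfl
  | cons i l ih => rw [List.map_cons, epsCount_cons_inr, ih, List.length_cons]

lemma finRange_eq_take_append_cons_drop (i : Fin m) :
    List.finRange m = (List.finRange m).take i ++ i :: (List.finRange m).drop (i + 1) := by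
  conv_lhs => rw [← List.take_append_drop i (List.finRange m),
    List.drop_eq_getElem_cons (by simp), List.getElem_finRange]
  simp

lemma standardSeq_eq_append_inl (n : ℕ) (i : Fin m) : ∃ suf, standardSeq m n =
    ((List.finRange m).take i).map Sum.inl ++ Sum.inl i :: suf := by
  refine ⟨((List.finRange m).drop (i + 1)).map Sum.inl ++ (List.finRange n).map Sum.inr, ?_⟩
  rw [standardSeq]
  conv_lhs => rw [finRange_eq_take_append_cons_drop i]
  simp

lemma standardSeq_eq_append_inr (m : ℕ) (j : Fin n) : ∃ suf, standardSeq m n =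
    ((List.finRange m).map Sum.inl ++ ((List.finRange n).take j).map Sum.inr) ++
      Sum.inr j :: suf := by
  refine ⟨((List.finRange n).drop (j + 1)).map Sum.inr, ?_⟩
  rw [standardSeq]
  conv_lhs => rw [finRange_eq_take_append_cons_drop j]
  simp

lemma readWeight_standardSeq (μ : YoungDiagram) :
    readWeight (standardSeq m n) μ = natural m n μ := by
  funext x
  have hnodup := nodup_standardSeq (m := m) (n := n)
  cases x with
  | inl i =>
    obtain ⟨suf, hsuf⟩ := standardSeq_eq_append_inl n i
    rw [hsuf] at hnodup ⊢
    rw [readWeight_append_cons_self (notMem_of_nodup_append_cons hnodup)]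
    simp [readCoeff, natural, deltaCount_map_inl, epsCount_map_inl, -List.map_take]
  | inr j =>
    obtain ⟨suf, hsuf⟩ := standardSeq_eq_append_inr m j
    rw [hsuf] at hnodup ⊢
    rw [readWeight_append_cons_self (notMem_of_nodup_append_cons hnodup)]
    simp [readCoeff, natural, -List.map_take, deltaCount_map_inl, epsCount_map_inl,
      deltaCount_map_inr, epsCount_map_inr, colLen_iterate_removeRow]

lemma standard_le_iff {i j : Idx m n} :
    (Borel.standard m n).le i j ↔ (toLex i : Fin m ⊕ₗ Fin n) ≤ toLex j := by
  refine ⟨fun h => not_lt.mp fun hlt => ?_, fun h => Matrix.blockTriangular_single h 1⟩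
  simpa [E] using h hlt

lemma indexSeq_standard : (Borel.standard m n).indexSeq = standardSeq m n := by
  refine List.Perm.eq_of_pairwise (le := (Borel.standard m n).le)
    (fun a b _ _ => Std.Antisymm.antisymm a b) (Borel.pairwise_indexSeq _) ?_
    ((List.perm_ext_iff_of_nodup (Borel.nodup_indexSeq _) nodup_standardSeq).mpr
      fun i => by simp [Borel.mem_indexSeq, mem_standardSeq])
  simp [standardSeq, List.pairwise_append, List.pairwise_map, standard_le_iff,
    List.pairwise_le_finRange]

theorem borelWeight_standard (μ : YoungDiagram) :
    borelWeight (Borel.standard m n) μ = natural m n μ := by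
  rw [borelWeight, indexSeq_standard, readWeight_standardSeq]

/-! ### Matrix units -/

lemma sign_zero_left (t : ZMod 2) : sign 0 t = 1 := by simp [sign]

lemma sign_add_self_of_ne {s t : ZMod 2} (h : s ≠ t) : sign (s + t) (s + t) = -1 := by
  have hval : (s + t).val = 1 := by
    revert s t
    decide
  rw [sign, hval, mul_one, pow_one]

lemma parity_add_self (i : Idx m n) : parity i + parity i = 0 := CharTwo.add_self_eq_zero _

lemma isHomog_E (i j : Idx m n) : IsHomog (parity i + parity j) (E i j) := by
  intro a b h
  rw [E, Matrix.single_apply, if_neg]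
  rintro ⟨rfl, rfl⟩
  exact h rfl

lemma E_mem_cartan (i : Idx m n) : E i i ∈ cartan m n := by
  intro a b hab
  rw [E, Matrix.single_apply, if_neg]
  rintro ⟨rfl, rfl⟩
  exact hab rfl

lemma E_mul_E (i j k l : Idx m n) : E i j * E k l = if j = k then E i l else (0 : Gl m n) := by
  split_ifs with h
  · subst h
    simp [E]
  · simp [E, Matrix.single_mul_single_of_ne, h]

lemma superBracket_E_E (i j k l : Idx m n) :
    superBracket (E i j) (E k l) = (if j = k then E i l else 0) -
      sign (parity i + parity j) (parity k + parity l) • (if l = i then E k j else 0) := by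
  simp only [superBracket, part_single]
  rw [Finset.sum_eq_single (parity i + parity j), Finset.sum_eq_single (parity k + parity l)]
  · simp only [if_true, E_mul_E]
  · intro t _ ht
    simp [ht.symm]
  · simp
  · intro s _ hs
    simp [hs.symm]
  · simp

lemma eq_sum_E (x : Gl m n) : x = ∑ i, ∑ j, x i j • E i j := by
  conv_lhs => rw [Matrix.matrix_eq_sum_single x]
  simp [E, Matrix.smul_single]

lemma eq_sum_E_of_mem_cartan {x : Gl m n} (hx : x ∈ cartan m n) : x = ∑ i, x i i • E i i := by
  conv_lhs => rw [eq_sum_E x]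
  refine Finset.sum_congr rfl fun i _ => Finset.sum_eq_single i (fun j _ hj => ?_) (by simp)
  rw [hx i j hj.symm, zero_smul]

/-! ### Orderings of the indices -/

section Position

variable {α : Type*}

lemma of_perm_of_swap {P : List α → Prop}
    (hP : ∀ pre a b suf, P (pre ++ a :: b :: suf) → P (pre ++ b :: a :: suf)) {l l' : List α}
    (hl : l.Perm l') (pre : List α) (h : P (pre ++ l)) : P (pre ++ l') := by
  induction hl generalizing pre with
  | nil => exact h
  | cons x _ ih =>
    rw [List.append_cons] at h ⊢
    exact ih _ h
  | swap x y l => exact hP _ _ _ _ h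
  | trans _ _ ih₁ ih₂ => exact ih₂ pre (ih₁ pre h)

variable [DecidableEq α]

/-- The position function of the ordering given by a list. -/
def position (l : List α) (x : α) : ℕ := l.idxOf x

lemma position_injective {l : List α} (hl : ∀ x, x ∈ l) : (position l).Injective :=
  fun x _ h => (List.idxOf_inj (hl x)).mp h

lemma position_getElem {l : List α} (hl : l.Nodup) {k : ℕ} (hk : k < l.length) :
    position l l[k] = k := hl.idxOf_getElem k hk

lemma position_append_cons_cons {pre : List α} {a b : α} (hab : a ≠ b) (ha : a ∉ pre)
    (hb : b ∉ pre) (suf : List α) :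
    position (pre ++ a :: b :: suf) b = position (pre ++ a :: b :: suf) a + 1 := by
  simp [position, List.idxOf_append_of_notMem, ha, hb, List.idxOf_cons_ne, hab]

lemma position_swap {pre : List α} {a b : α} (ha : a ∉ pre) (hb : b ∉ pre) (suf : List α) :
    position (pre ++ b :: a :: suf) = position (pre ++ a :: b :: suf) ∘ Equiv.swap a b := by
  funext x
  simp only [position, Function.comp_apply, Equiv.swap_apply_def, List.idxOf_append,
    List.idxOf_cons]
  grind

lemma lt_of_comp_swap_lt {p : α → ℕ} (hp : p.Injective) {a b i j : α}
    (hab : p b = p a + 1) (hij : (p ∘ Equiv.swap a b) i < (p ∘ Equiv.swap a b) j) :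
    (i = b ∧ j = a) ∨ (p i < p j ∧ ¬(i = a ∧ j = b)) := by
  have hpa {x : α} (hx : x ≠ a) : p x ≠ p a := hp.ne hx
  have hpb {x : α} (hx : x ≠ b) : p x ≠ p b := hp.ne hx
  simp only [Function.comp_apply, Equiv.swap_apply_def] at hij
  grind

end Position

lemma Borel.position_lt_iff (B : Borel m n) {i j : Idx m n} :
    position B.indexSeq i < position B.indexSeq j ↔ i ≠ j ∧ B.le i j := by
  obtain ⟨a, ha, rfl⟩ := List.getElem_of_mem (B.mem_indexSeq i)
  obtain ⟨b, hb, rfl⟩ := List.getElem_of_mem (B.mem_indexSeq j)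
  rw [position_getElem B.nodup_indexSeq, position_getElem B.nodup_indexSeq]
  refine ⟨fun hab => ⟨?_, B.le_getElem hab hb⟩, fun h => B.lt_of_le_getElem ha hb h.1 h.2⟩
  exact fun h => hab.ne (B.nodup_indexSeq.getElem_inj_iff.mp h)

/-- The cone spanned by the roots that are positive for the ordering of the indices given by the
position function `p`. -/
def posCone (p : Idx m n → ℕ) : AddSubmonoid (Weight m n) :=
  AddSubmonoid.closure {α | ∃ i j, p i < p j ∧ α = root i j}

lemma root_mem_posCone {p : Idx m n → ℕ} {i j : Idx m n} (hij : p i < p j) :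
    root i j ∈ posCone p := AddSubmonoid.subset_closure ⟨i, j, hij, rfl⟩

lemma neg_root (i j : Idx m n) : -root i j = root j i := neg_sub _ _

lemma exists_dotProduct_eq_neg_of_mem_posCone {p : Idx m n → ℕ} {α : Weight m n}
    (hα : α ∈ posCone p) :
    ∃ k : ℕ, (α ⬝ᵥ fun i => (p i : ℂ)) = -k ∧ (k = 0 → α = 0) := by
  induction hα using AddSubmonoid.closure_induction with
  | mem α hα =>
    obtain ⟨i, j, hij, rfl⟩ := hα
    refine ⟨p j - p i, ?_, fun h => by omega⟩
    rw [root, sub_dotProduct, single_dotProduct, single_dotProduct, Nat.cast_sub hij.le]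
    ring
  | zero => exact ⟨0, by simp⟩
  | add α β _ _ hα hβ =>
    obtain ⟨k, hk, hk0⟩ := hα
    obtain ⟨l, hl, hl0⟩ := hβ
    refine ⟨k + l, ?_, fun h => ?_⟩
    · rw [add_dotProduct, hk, hl]
      push_cast
      ring
    · rw [hk0 (by omega), hl0 (by omega), add_zero]

lemma eq_zero_of_mem_posCone_of_neg_mem_posCone {p : Idx m n → ℕ} {α : Weight m n}
    (hα : α ∈ posCone p) (hα' : -α ∈ posCone p) : α = 0 := by
  obtain ⟨k, hk, hk0⟩ := exists_dotProduct_eq_neg_of_mem_posCone hα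
  obtain ⟨l, hl, -⟩ := exists_dotProduct_eq_neg_of_mem_posCone hα'
  rw [neg_dotProduct, hk, neg_neg, eq_neg_iff_add_eq_zero] at hl
  have hkl : k + l = 0 := by exact_mod_cast hl
  exact hk0 (by omega)

lemma coe_decompose_map {ι R V : Type*} [DecidableEq ι] [Semiring R] [AddCommMonoid V]
    [Module R V] (𝒱 : ι → Submodule R V) [DirectSum.Decomposition 𝒱] {T : V →ₗ[R] V} {f : ι → ι}
    (hf : f.Injective) (hT : ∀ i, ∀ x ∈ 𝒱 i, T x ∈ 𝒱 (f i)) (x : V) (i : ι) :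
    (DirectSum.decompose 𝒱 (T x) (f i) : V) = T (DirectSum.decompose 𝒱 x i) := by
  induction x using DirectSum.Decomposition.inductionOn 𝒱 with
  | zero => simp
  | @homogeneous j x =>
    rcases eq_or_ne j i with rfl | hji
    · rw [DirectSum.decompose_of_mem_same _ (hT j x x.2),
        DirectSum.decompose_of_mem_same _ x.2]
    · rw [DirectSum.decompose_of_mem_ne _ (hT j x x.2) (hf.ne hji),
        DirectSum.decompose_of_mem_ne _ x.2 hji, map_zero]
  | add x y hx hy => simp [hx, hy]

namespace SuperModule

variable {L : Type*} [AddCommGroup L] [Module ℂ L] {M : SuperModule m n L}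

/-! ### Weight spaces -/

lemma act_E_act_E (i j k l : Idx m n) (v : L) :
    M.act (E i j) (M.act (E k l) v) = M.act (superBracket (E i j) (E k l)) v +
      sign (parity i + parity j) (parity k + parity l) • M.act (E k l) (M.act (E i j) v) := by
  rw [M.act_bracket _ _ _ _ (isHomog_E i j) (isHomog_E k l)]
  simp

lemma commute_act_E_self (i j : Idx m n) : Commute (M.act (E i i)) (M.act (E j j)) := by
  refine LinearMap.ext fun v => ?_
  rw [Module.End.mul_apply, Module.End.mul_apply, act_E_act_E, superBracket_E_E, parity_add_self,
    sign_zero_left]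
  rcases eq_or_ne i j with rfl | hij <;> simp [*, Ne.symm]

variable (M) in
/-- The space of all vectors of weight `μ`. -/
def weightSpace (μ : Weight m n) : Submodule ℂ L := ⨅ i, (M.act (E i i)).eigenspace (μ i)

lemma mem_weightSpace_iff {μ : Weight m n} {v : L} :
    v ∈ M.weightSpace μ ↔ ∀ i, M.act (E i i) v = μ i • v := by
  simp only [weightSpace, Submodule.mem_iInf, Module.End.mem_eigenspace_iff]

lemma iSupIndep_weightSpace : iSupIndep M.weightSpace := by
  refine (Module.End.independent_iInf_maxGenEigenspace_of_forall_mapsTo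
    (fun i => M.act (E i i)) fun i j c =>
      Module.End.mapsTo_maxGenEigenspace_of_comm (commute_act_E_self j i) c).mono fun μ =>
    iInf_mono fun i => Module.End.eigenspace_le_maxGenEigenspace

lemma act_mem_weightSpace {μ : Weight m n} {v : L} (hv : v ∈ M.weightSpace μ) (i j : Idx m n) :
    M.act (E i j) v ∈ M.weightSpace (μ + root i j) := by
  rw [mem_weightSpace_iff] at hv ⊢
  intro c
  rw [act_E_act_E, superBracket_E_E, parity_add_self, sign_zero_left, one_smul, one_smul, hv c,
    map_smul, Pi.add_apply, add_smul, add_comm]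
  congr 1
  rcases eq_or_ne c i with rfl | hi <;> rcases eq_or_ne j c with rfl | hj <;> simp [root, *]

lemma pow_act_mem_weightSpace {μ : Weight m n} {v : L} (hv : v ∈ M.weightSpace μ)
    (i j : Idx m n) (r : ℕ) :
    (M.act (E i j) ^ r) v ∈ M.weightSpace (μ + (r : ℂ) • root i j) := by
  induction r with
  | zero => simpa using hv
  | succ r ih =>
    rw [pow_succ', Module.End.mul_apply]
    convert act_mem_weightSpace ih i j using 2
    push_cast
    module

lemma act_cartan_of_mem_weightSpace {μ : Weight m n} {v : L} (hv : v ∈ M.weightSpace μ)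
    {x : Gl m n} (hx : x ∈ cartan m n) : M.act x v = (∑ i, μ i * x i i) • v := by
  conv_lhs => rw [eq_sum_E_of_mem_cartan hx]
  simp only [map_sum, map_smul, LinearMap.sum_apply, LinearMap.smul_apply,
    mem_weightSpace_iff.mp hv, smul_smul, Finset.sum_smul, mul_comm]

lemma mem_weightSpace_iff_forall_cartan {μ : Weight m n} {v : L} :
    v ∈ M.weightSpace μ ↔ ∀ h ∈ cartan m n, M.act h v = (∑ i, μ i * h i i) • v := by
  refine ⟨fun hv h => act_cartan_of_mem_weightSpace hv,
    fun h => mem_weightSpace_iff.mpr fun i => ?_⟩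
  rw [h _ (E_mem_cartan i)]
  simp [E, Matrix.single_apply]

/-! ### Primitive vectors -/

variable (M) in
/-- `v` is a highest weight vector of weight `μ` for the Borel subalgebra whose positive roots are
the `root i j` with `p i < p j`; the ordering of the indices is encoded by the position function
`p`. -/
structure IsPrimitive (p : Idx m n → ℕ) (μ : Weight m n) (v : L) : Prop where
  ne_zero : v ≠ 0
  act_eq_zero : ∀ i j, p i < p j → M.act (E i j) v = 0
  mem_weightSpace : v ∈ M.weightSpace μ

lemma IsPrimitive.exists_homogeneous {p : Idx m n → ℕ} {μ : Weight m n} {v : L}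
    (hv : M.IsPrimitive p μ v) : ∃ s, ∃ u ∈ M.grade s, M.IsPrimitive p μ u := by
  classical
  let := M.isInternal.chooseDecomposition
  have hcomp (i j : Idx m n) := coe_decompose_map M.grade (T := M.act (E i j))
    (add_right_injective (parity i + parity j)) fun t x => M.act_mem _ t _ x (isHomog_E i j)
  obtain ⟨s, hs⟩ : ∃ s, (DirectSum.decompose M.grade v s : L) ≠ 0 := by
    by_contra! h
    apply hv.ne_zero
    rw [← DirectSum.sum_support_decompose M.grade v]
    exact Finset.sum_eq_zero fun i _ => h i
  refine ⟨s, _, SetLike.coe_mem _, hs, fun i j hij => ?_, mem_weightSpace_iff.mpr fun i => ?_⟩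
  · rw [← hcomp, hv.act_eq_zero i j hij]
    simp
  · have h := hcomp i i v s
    rw [parity_add_self, zero_add] at h
    rw [← h, mem_weightSpace_iff.mp hv.mem_weightSpace i, DirectSum.decompose_smul]
    rfl

variable (M) in
/-- The vectors obtained from `v` by repeated application of negative root vectors. -/
inductive Lowered (p : Idx m n → ℕ) (v : L) : L → Prop
  | refl : Lowered p v v
  | act {u : L} {i j : Idx m n} (hij : p i < p j) (hu : Lowered p v u) :
      Lowered p v (M.act (E j i) u)

variable (M) in
/-- The span of all vectors obtained from `v` by the action of negative root vectors. -/
def lowerSpan (p : Idx m n → ℕ) (v : L) : Submodule ℂ L := Submodule.span ℂ {u | M.Lowered p v u}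

lemma Lowered.mem_lowerSpan {p : Idx m n → ℕ} {v u : L} (hu : M.Lowered p v u) :
    u ∈ M.lowerSpan p v := Submodule.subset_span hu

lemma Lowered.exists_mem_grade {p : Idx m n → ℕ} {v u : L} (hu : M.Lowered p v u) {s : ZMod 2}
    (hv : v ∈ M.grade s) : ∃ t, u ∈ M.grade t := by
  induction hu with
  | refl => exact ⟨s, hv⟩
  | act _ _ ih =>
    obtain ⟨t, ht⟩ := ih
    exact ⟨_, M.act_mem _ _ _ _ (isHomog_E _ _) ht⟩

lemma Lowered.exists_mem_weightSpace {p : Idx m n → ℕ} {v u : L} (hu : M.Lowered p v u)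
    {μ : Weight m n} (hv : v ∈ M.weightSpace μ) :
    ∃ κ, μ - κ ∈ posCone p ∧ u ∈ M.weightSpace κ := by
  induction hu with
  | refl => exact ⟨μ, by simp, hv⟩
  | @act _ i j hij _ ih =>
    obtain ⟨κ, hκ, hu⟩ := ih
    refine ⟨_, ?_, act_mem_weightSpace hu j i⟩
    rw [← neg_root i j, ← sub_eq_add_neg, sub_sub_eq_add_sub, add_sub_right_comm]
    exact add_mem hκ (root_mem_posCone hij)

lemma act_mem_lowerSpan_of_lt {p : Idx m n → ℕ} {v u : L} {i j : Idx m n} (hij : p i < p j)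
    (hu : u ∈ M.lowerSpan p v) : M.act (E j i) u ∈ M.lowerSpan p v := by
  suffices M.lowerSpan p v ≤ (M.lowerSpan p v).comap (M.act (E j i)) from this hu
  exact Submodule.span_le.mpr fun _ hu => (hu.act hij).mem_lowerSpan

lemma act_mem_of_forall_act_E_mem {N : Submodule ℂ L} {u : L} (h : ∀ i j, M.act (E i j) u ∈ N)
    (x : Gl m n) : M.act x u ∈ N := by
  rw [eq_sum_E x]
  simp only [map_sum, map_smul, LinearMap.sum_apply, LinearMap.smul_apply]
  exact sum_mem fun i _ => sum_mem fun j _ => N.smul_mem _ (h i j)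

lemma IsPrimitive.act_mem_lowerSpan_of_lowered {p : Idx m n → ℕ} (hp : p.Injective)
    {μ : Weight m n} {v u : L} (hv : M.IsPrimitive p μ v) (hu : M.Lowered p v u) (x : Gl m n) :
    M.act x u ∈ M.lowerSpan p v := by
  induction hu generalizing x with
  | refl =>
    refine act_mem_of_forall_act_E_mem (fun i j => ?_) x
    rcases lt_trichotomy (p i) (p j) with h | h | h
    · rw [hv.act_eq_zero i j h]
      exact zero_mem _
    · rw [hp h, mem_weightSpace_iff.mp hv.mem_weightSpace j]
      exact Submodule.smul_mem _ _ Lowered.refl.mem_lowerSpan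
    · exact act_mem_lowerSpan_of_lt h Lowered.refl.mem_lowerSpan
  | act hij _ ih =>
    refine act_mem_of_forall_act_E_mem (fun i j => ?_) x
    rw [act_E_act_E]
    exact add_mem (ih _) (Submodule.smul_mem _ _ (act_mem_lowerSpan_of_lt hij (ih _)))

lemma IsPrimitive.isSubmodule_lowerSpan {p : Idx m n → ℕ} (hp : p.Injective) {μ : Weight m n}
    {v : L} (hv : M.IsPrimitive p μ v) {s : ZMod 2} (hs : v ∈ M.grade s) :
    M.IsSubmodule (M.lowerSpan p v) := by
  refine ⟨Submodule.span_le.mpr fun u hu => ?_, fun x u hu => ?_⟩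
  · obtain ⟨t, ht⟩ := hu.exists_mem_grade hs
    exact Submodule.mem_iSup_of_mem t ⟨hu.mem_lowerSpan, ht⟩
  · suffices M.lowerSpan p v ≤ (M.lowerSpan p v).comap (M.act x) from this hu
    exact Submodule.span_le.mpr fun _ hu => hv.act_mem_lowerSpan_of_lowered hp hu x

lemma IsSimple.lowerSpan_eq_top (hM : M.IsSimple) {p : Idx m n → ℕ} (hp : p.Injective)
    {μ : Weight m n} {v : L} (hv : M.IsPrimitive p μ v) {s : ZMod 2} (hs : v ∈ M.grade s) :
    M.lowerSpan p v = ⊤ := by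
  refine (hM.2 _ (hv.isSubmodule_lowerSpan hp hs)).resolve_left fun h => hv.ne_zero ?_
  have hmem : v ∈ M.lowerSpan p v := Lowered.refl.mem_lowerSpan
  rwa [h, Submodule.mem_bot] at hmem

theorem IsSimple.sub_mem_posCone (hM : M.IsSimple) {p : Idx m n → ℕ} (hp : p.Injective)
    {μ ν : Weight m n} {v w : L} (hv : M.IsPrimitive p μ v) (hw : w ≠ 0)
    (hwν : w ∈ M.weightSpace ν) : μ - ν ∈ posCone p := by
  obtain ⟨s, u, hs, hu⟩ := hv.exists_homogeneous
  by_contra hν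
  have hle : M.lowerSpan p u ≤ ⨆ κ, ⨆ _ : κ ≠ ν, M.weightSpace κ := by
    refine Submodule.span_le.mpr fun x hx => ?_
    obtain ⟨κ, hκ, hxκ⟩ := hx.exists_mem_weightSpace hu.mem_weightSpace
    exact Submodule.mem_iSup_of_mem κ
      (Submodule.mem_iSup_of_mem (by rintro rfl; exact hν hκ) hxκ)
  rw [hM.lowerSpan_eq_top hp hu hs] at hle
  exact hw (Submodule.disjoint_def.mp (iSupIndep_weightSpace ν) w hwν (hle Submodule.mem_top))

theorem IsSimple.weight_unique (hM : M.IsSimple) {p : Idx m n → ℕ} (hp : p.Injective)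
    {μ ν : Weight m n} {v w : L} (hv : M.IsPrimitive p μ v) (hw : M.IsPrimitive p ν w) :
    μ = ν := by
  refine sub_eq_zero.mp (eq_zero_of_mem_posCone_of_neg_mem_posCone
    (hM.sub_mem_posCone hp hv hw.ne_zero hw.mem_weightSpace) ?_)
  rw [neg_sub]
  exact hM.sub_mem_posCone hp hw hv.ne_zero hv.mem_weightSpace

/-! ### Changing the Borel subalgebra -/

variable (M) in
/-- `w` is killed by all positive root vectors for the ordering `p` except possibly `E a b`. When
`a` immediately precedes `b`, these are the root vectors that stay positive when `a` and `b` are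
interchanged. -/
def KilledExcept (p : Idx m n → ℕ) (a b : Idx m n) (w : L) : Prop :=
  ∀ i j, p i < p j → ¬(i = a ∧ j = b) → M.act (E i j) w = 0

lemma IsPrimitive.killedExcept {p : Idx m n → ℕ} {μ : Weight m n} {v : L}
    (hv : M.IsPrimitive p μ v) (a b : Idx m n) : M.KilledExcept p a b v :=
  fun i j hij _ => hv.act_eq_zero i j hij

lemma KilledExcept.isPrimitive {p : Idx m n → ℕ} {a b : Idx m n} {ν : Weight m n} {w : L}
    (hw : M.KilledExcept p a b w) (hne : w ≠ 0) (hab : M.act (E a b) w = 0)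
    (hν : w ∈ M.weightSpace ν) : M.IsPrimitive p ν w where
  ne_zero := hne
  act_eq_zero i j hij := by
    by_cases h : i = a ∧ j = b
    · rw [h.1, h.2, hab]
    · exact hw i j hij h
  mem_weightSpace := hν

lemma KilledExcept.isPrimitive_swap {p : Idx m n → ℕ} (hp : p.Injective) {a b : Idx m n}
    (hab : p b = p a + 1) {ν : Weight m n} {w : L} (hw : M.KilledExcept p a b w) (hne : w ≠ 0)
    (hba : M.act (E b a) w = 0) (hν : w ∈ M.weightSpace ν) :
    M.IsPrimitive (p ∘ Equiv.swap a b) ν w where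
  ne_zero := hne
  act_eq_zero i j hij := by
    rcases lt_of_comp_swap_lt hp hab hij with ⟨rfl, rfl⟩ | ⟨hij, h⟩
    · exact hba
    · exact hw i j hij h
  mem_weightSpace := hν

lemma KilledExcept.act {p : Idx m n → ℕ} (hp : p.Injective) {a b : Idx m n}
    (hab : p b = p a + 1) {w : L} (hw : M.KilledExcept p a b w) :
    M.KilledExcept p a b (M.act (E b a) w) := by
  intro i j hij hne
  have hi : M.act (if j = b then E i a else 0) w = 0 := by
    split_ifs with h
    · subst h
      have hia : p i ≠ p a := fun h => hne ⟨hp h, rfl⟩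
      exact hw i a (by omega) fun h => hia (congrArg p h.1)
    · rw [map_zero, LinearMap.zero_apply]
  have hj : M.act (if a = i then E b j else 0) w = 0 := by
    split_ifs with h
    · subst h
      have hjb : p j ≠ p b := fun h => hne ⟨rfl, hp h⟩
      exact hw b j (by omega) fun h => hjb (congrArg p h.2)
    · rw [map_zero, LinearMap.zero_apply]
  rw [act_E_act_E, hw i j hij hne, superBracket_E_E, map_sub, map_smul, LinearMap.sub_apply,
    LinearMap.smul_apply, hi, hj, map_zero, smul_zero, sub_zero, add_zero]

lemma KilledExcept.pow_act {p : Idx m n → ℕ} (hp : p.Injective) {a b : Idx m n}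
    (hab : p b = p a + 1) {w : L} (hw : M.KilledExcept p a b w) (r : ℕ) :
    M.KilledExcept p a b ((M.act (E b a) ^ r) w) := by
  induction r with
  | zero => exact hw
  | succ r ih =>
    rw [pow_succ', Module.End.mul_apply]
    exact ih.act hp hab

lemma act_E_act_E_symm {μ : Weight m n} {v : L} (hv : v ∈ M.weightSpace μ) (a b : Idx m n) :
    M.act (E a b) (M.act (E b a) v) =
      (μ a - sign (parity a + parity b) (parity a + parity b) * μ b) • v +
        sign (parity a + parity b) (parity a + parity b) •
          M.act (E b a) (M.act (E a b) v) := by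
  rw [mem_weightSpace_iff] at hv
  rw [act_E_act_E, superBracket_E_E, add_comm (parity b) (parity a)]
  simp [hv a, hv b, sub_smul, mul_smul]

lemma act_E_pow_succ {a b : Idx m n} (hpar : parity a = parity b) {μ : Weight m n} {v : L}
    (hv : v ∈ M.weightSpace μ) (hab : a ≠ b) (hzero : M.act (E a b) v = 0) (r : ℕ) :
    M.act (E a b) ((M.act (E b a) ^ (r + 1)) v) =
      ((r + 1) * (μ a - μ b - r) : ℂ) • (M.act (E b a) ^ r) v := by
  have hsign : sign (parity a + parity b) (parity a + parity b) = 1 := by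
    rw [hpar, parity_add_self, sign_zero_left]
  induction r with
  | zero => simp [act_E_act_E_symm hv, hsign, hzero]
  | succ r ih =>
    rw [pow_succ', Module.End.mul_apply, act_E_act_E_symm (pow_act_mem_weightSpace hv b a (r + 1)),
      hsign, ih, map_smul, ← Module.End.mul_apply, ← pow_succ', one_smul, ← add_smul]
    congr 1
    simp [root, hab, hab.symm]
    ring

lemma act_E_act_E_self {a b : Idx m n} (hpar : parity a ≠ parity b) (v : L) :
    M.act (E a b) (M.act (E a b) v) = 0 := by
  have hab : a ≠ b := ne_of_apply_ne parity hpar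
  have : IsAddTorsionFree L := .of_isTorsionFree ℂ L
  refine self_eq_neg.mp ?_
  conv_lhs => rw [act_E_act_E, superBracket_E_E, sign_add_self_of_ne hpar]
  simp [hab.symm]

lemma IsSimple.pow_act_eq_zero (hM : M.IsSimple) {p : Idx m n → ℕ} (hp : p.Injective)
    {a b : Idx m n} (hab : p b = p a + 1) {μ : Weight m n} {v : L} (hv : M.IsPrimitive p μ v)
    {r : ℕ} (hr : M.act (E a b) ((M.act (E b a) ^ (r + 1)) v) = 0) :
    (M.act (E b a) ^ (r + 1)) v = 0 := by
  by_contra hne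
  have hab' : b ≠ a := by
    rintro rfl
    omega
  have hweight := hM.weight_unique hp hv
    (((hv.killedExcept a b).pow_act hp hab _).isPrimitive hne hr
      (pow_act_mem_weightSpace hv.mem_weightSpace b a (r + 1)))
  have : ((r + 1 : ℕ) : ℂ) = 0 := by simpa [root, hab'] using congrFun hweight b
  exact Nat.cast_ne_zero.mpr r.succ_ne_zero this

lemma IsSimple.exists_isPrimitive_reflect_of_parity_eq (hM : M.IsSimple) {p : Idx m n → ℕ}
    (hp : p.Injective) {a b : Idx m n} (hab : p b = p a + 1) (hpar : parity a = parity b)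
    {μ : Weight m n} {k : ℕ} (hk : μ a = μ b + k) {v : L} (hv : M.IsPrimitive p μ v) :
    ∃ w, M.IsPrimitive (p ∘ Equiv.swap a b) (reflect a b μ) w := by
  have hne : a ≠ b := by
    rintro rfl
    omega
  have hsl := act_E_pow_succ hpar hv.mem_weightSpace hne (hv.act_eq_zero a b (by omega))
  have hpow_ne : ∀ r ≤ k, (M.act (E b a) ^ r) v ≠ 0 := by
    intro r hrk
    induction r with
    | zero => exact hv.ne_zero
    | succ r ih =>
      intro h
      have hcoeff : ((r + 1) * (μ a - μ b - r) : ℂ) ≠ 0 := by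
        rw [hk, add_sub_cancel_left, ← Nat.cast_sub (by omega)]
        exact mul_ne_zero r.cast_add_one_ne_zero (Nat.cast_ne_zero.mpr (by omega))
      exact smul_ne_zero hcoeff (ih (by omega)) (by rw [← hsl, h, map_zero])
  have hpow_succ : M.act (E b a) ((M.act (E b a) ^ k) v) = 0 := by
    rw [← Module.End.mul_apply, ← pow_succ']
    refine hM.pow_act_eq_zero hp hab hv ?_
    rw [hsl, hk, add_sub_cancel_left, sub_self, mul_zero, zero_smul]
  rw [reflect_eq_add_smul_root hpar hk]
  exact ⟨_, ((hv.killedExcept a b).pow_act hp hab k).isPrimitive_swap hp hab (hpow_ne k le_rfl)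
    hpow_succ (pow_act_mem_weightSpace hv.mem_weightSpace b a k)⟩

lemma IsSimple.exists_isPrimitive_reflect_of_parity_ne (hM : M.IsSimple) {p : Idx m n → ℕ}
    (hp : p.Injective) {a b : Idx m n} (hab : p b = p a + 1) (hpar : parity a ≠ parity b)
    {μ : Weight m n} {v : L} (hv : M.IsPrimitive p μ v) :
    ∃ w, M.IsPrimitive (p ∘ Equiv.swap a b) (reflect a b μ) w := by
  have hef : M.act (E a b) (M.act (E b a) v) = (μ a + μ b) • v := by
    rw [act_E_act_E_symm hv.mem_weightSpace, sign_add_self_of_ne hpar,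
      hv.act_eq_zero a b (by omega)]
    simp
  by_cases horth : μ a + μ b = 0
  · rw [reflect_of_add_eq_zero hpar horth]
    refine ⟨v, (hv.killedExcept a b).isPrimitive_swap hp hab hv.ne_zero ?_ hv.mem_weightSpace⟩
    have hzero := hM.pow_act_eq_zero hp hab hv (r := 0)
    rw [zero_add, pow_one] at hzero
    exact hzero (by rw [hef, horth, zero_smul])
  · rw [reflect_of_add_ne_zero hpar horth, sub_eq_add_neg, neg_root]
    refine ⟨_, ((hv.killedExcept a b).act hp hab).isPrimitive_swap hp hab (fun h => ?_)
      (act_E_act_E_self hpar.symm v) (act_mem_weightSpace hv.mem_weightSpace b a)⟩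
    rw [h, map_zero] at hef
    exact smul_ne_zero horth hv.ne_zero hef.symm

lemma isHighestWeightVector_iff {B : Borel m n} {μ : Weight m n} {v : L} :
    M.IsHighestWeightVector B μ v ↔ M.IsPrimitive (position B.indexSeq) μ v := by
  refine ⟨fun ⟨hne, hnil, hwt⟩ =>
      ⟨hne, fun i j hij => ?_, mem_weightSpace_iff_forall_cartan.mpr hwt⟩,
    fun hv =>
      ⟨hv.ne_zero, fun x hx => ?_, mem_weightSpace_iff_forall_cartan.mp hv.mem_weightSpace⟩⟩
  · obtain ⟨hne, hle⟩ := B.position_lt_iff.mp hij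
    exact hnil _ (Submodule.subset_span ⟨i, j, hne, hle, rfl⟩)
  · suffices B.nilradical ≤ LinearMap.ker (M.act.flip v) from this hx
    refine Submodule.span_le.mpr ?_
    rintro _ ⟨i, j, hne, hle, rfl⟩
    exact hv.act_eq_zero i j (B.position_lt_iff.mpr ⟨hne, hle⟩)

lemma IsSimple.exists_isPrimitive_readWeight_swap (hM : M.IsSimple) {pre suf : List (Idx m n)}
    {a b : Idx m n} (hnodup : (pre ++ a :: b :: suf).Nodup)
    (hmem : ∀ i, i ∈ pre ++ a :: b :: suf) {lam : YoungDiagram} {v : L}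
    (hv : M.IsPrimitive (position (pre ++ a :: b :: suf))
      (readWeight (pre ++ a :: b :: suf) lam) v) :
    ∃ w, M.IsPrimitive (position (pre ++ b :: a :: suf))
      (readWeight (pre ++ b :: a :: suf) lam) w := by
  have hab : a ≠ b := by
    rintro rfl
    simp [List.nodup_append] at hnodup
  have ha : a ∉ pre := notMem_of_nodup_append_cons hnodup
  have hb : b ∉ pre := by
    rw [List.append_cons] at hnodup
    exact fun h => notMem_of_nodup_append_cons hnodup (List.mem_append_left _ h)
  have hinj := position_injective hmem
  have hsucc := position_append_cons_cons hab ha hb suf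
  rw [readWeight_swap hab ha hb, position_swap ha hb]
  by_cases hpar : parity a = parity b
  · obtain ⟨k, hk⟩ := exists_readWeight_eq_add hab hpar ha hb suf lam
    exact hM.exists_isPrimitive_reflect_of_parity_eq hinj hsucc hpar hk hv
  · exact hM.exists_isPrimitive_reflect_of_parity_ne hinj hsucc hpar hv

lemma IsSimple.exists_isPrimitive_readWeight_of_perm (hM : M.IsSimple) {l l' : List (Idx m n)}
    (hperm : l.Perm l') (hnodup : l.Nodup) (hmem : ∀ i, i ∈ l) {lam : YoungDiagram}
    (h : ∃ v, M.IsPrimitive (position l) (readWeight l lam) v) :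
    ∃ v, M.IsPrimitive (position l') (readWeight l' lam) v := by
  refine (of_perm_of_swap (P := fun l₁ => l.Perm l₁ ∧
    ∃ v, M.IsPrimitive (position l₁) (readWeight l₁ lam) v) ?_ hperm [] ⟨.refl l, h⟩).2
  rintro pre a b suf ⟨hl, v, hv⟩
  exact ⟨hl.trans ((List.Perm.swap b a suf).append_left pre),
    hM.exists_isPrimitive_readWeight_swap (hl.nodup hnodup) (fun i => hl.subset (hmem i)) hv⟩

lemma IsSimple.hasHighestWeight_borelWeight (hM : M.IsSimple) {B : Borel m n} (B' : Borel m n)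
    {lam : YoungDiagram} (h : M.HasHighestWeight B (borelWeight B lam)) :
    M.HasHighestWeight B' (borelWeight B' lam) := by
  simp only [HasHighestWeight, isHighestWeightVector_iff] at h ⊢
  refine hM.exists_isPrimitive_readWeight_of_perm ?_ B.nodup_indexSeq B.mem_indexSeq h
  exact (List.perm_ext_iff_of_nodup B.nodup_indexSeq B'.nodup_indexSeq).mpr fun i =>
    iff_of_true (B.mem_indexSeq i) (B'.mem_indexSeq i)

theorem IsSimple.hasHighestWeight_iff (hM : M.IsSimple) {B : Borel m n} (B' : Borel m n)
    {lam : YoungDiagram} (h : M.HasHighestWeight B (borelWeight B lam)) (μ : Weight m n) :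
    M.HasHighestWeight B' μ ↔ μ = borelWeight B' lam := by
  obtain ⟨w, hw⟩ := hM.hasHighestWeight_borelWeight B' h
  refine ⟨fun ⟨v, hv⟩ => ?_, fun hμ => ⟨w, hμ ▸ hw⟩⟩
  exact hM.weight_unique (position_injective B'.mem_indexSeq) (isHighestWeightVector_iff.mp hv)
    (isHighestWeightVector_iff.mp hw)

end SuperModule

end GLSuper

theorem mainTheorem4_general (m n : ℕ) (lam : YoungDiagram) (B : GLSuper.Borel m n) :
    (∀ (L : Type*) [AddCommGroup L] [Module ℂ L] (M : GLSuper.SuperModule m n L),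
      M.IsSimple →
      M.HasHighestWeight (GLSuper.Borel.standard m n) (GLSuper.natural m n lam) →
      ∀ μ : GLSuper.Weight m n,
        M.HasHighestWeight B μ ↔ μ = GLSuper.borelWeight B lam) ∧
    (B.AllOdd →
      ((∃ i, B.indexSeq.head? = some (Sum.inl i)) →
        (∀ k i, B.deltaSeq[k]? = some i →
          GLSuper.borelWeight B lam (Sum.inl i) = (GLSuper.frobP lam k : ℂ)) ∧
        (∀ k j, B.epsSeq[k]? = some j →
          GLSuper.borelWeight B lam (Sum.inr j) = (GLSuper.frobQ lam k : ℂ))) ∧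
      ((∃ j, B.indexSeq.head? = some (Sum.inr j)) →
        (∀ k j, B.epsSeq[k]? = some j →
          GLSuper.borelWeight B lam (Sum.inr j) = (GLSuper.frobP lam.transpose k : ℂ)) ∧
        (∀ k i, B.deltaSeq[k]? = some i →
          GLSuper.borelWeight B lam (Sum.inl i) = (GLSuper.frobQ lam.transpose k : ℂ)))) := by
  refine ⟨fun L _ _ M hM h => ?_, fun hodd => ⟨?_, ?_⟩⟩
  · rw [← GLSuper.borelWeight_standard] at h
    exact hM.hasHighestWeight_iff B h
  · rintro ⟨i₀, hi₀⟩
    refine ⟨fun k i hi => ?_, fun k j hj => ?_⟩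
    · simp [hodd.borelWeight_inl hi₀ hi, GLSuper.frobP_eq, GLSuper.parity]
    · simp [hodd.borelWeight_inr hi₀ hj, GLSuper.frobQ_eq, GLSuper.parity]
  · rintro ⟨j₀, hj₀⟩
    refine ⟨fun k j hj => ?_, fun k i hi => ?_⟩
    · simp [hodd.borelWeight_inr hj₀ hj, GLSuper.frobP_eq, GLSuper.parity, ZMod.val_one]
    · simp [hodd.borelWeight_inl hj₀ hi, GLSuper.frobQ_eq, GLSuper.parity, ZMod.val_one]

theorem mainTheorem4 (m n : ℕ) (lam : YoungDiagram) (hlam : GLSuper.IsHook m n lam)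
    (B : GLSuper.Borel m n) :
    (∀ (L : Type*) [AddCommGroup L] [Module ℂ L] (M : GLSuper.SuperModule m n L),
      M.IsSimple →
      M.HasHighestWeight (GLSuper.Borel.standard m n) (GLSuper.natural m n lam) →
      ∀ μ : GLSuper.Weight m n,
        M.HasHighestWeight B μ ↔ μ = GLSuper.borelWeight B lam) ∧
    (B.AllOdd →
      ((∃ i, B.indexSeq.head? = some (Sum.inl i)) →
        (∀ k i, B.deltaSeq[k]? = some i →
          GLSuper.borelWeight B lam (Sum.inl i) = (GLSuper.frobP lam k : ℂ)) ∧
        (∀ k j, B.epsSeq[k]? = some j →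
          GLSuper.borelWeight B lam (Sum.inr j) = (GLSuper.frobQ lam k : ℂ))) ∧
      ((∃ j, B.indexSeq.head? = some (Sum.inr j)) →
        (∀ k j, B.epsSeq[k]? = some j →
          GLSuper.borelWeight B lam (Sum.inr j) = (GLSuper.frobP lam.transpose k : ℂ)) ∧
        (∀ k i, B.deltaSeq[k]? = some i →
          GLSuper.borelWeight B lam (Sum.inl i) = (GLSuper.frobQ lam.transpose k : ℂ)))) :=
  mainTheorem4_general m n lam B
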